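/- Let $G$ be a finite simple graph with vertex set $V$. A biclique on $V$ is given by two disjoint (possibly empty) subsets $X, Y \subseteq V$, its partite sets; two vertices are adjacent in it if one lies in $X$ and the other in $Y$. An odd cover of $G$ is a finite collection of bicliques on $V$ such that any two vertices are adjacent in an odd number of the bicliques if and only if they are adjacent in $G$. Let $b_2(G)$ denote the minimum cardinality of an odd cover of $G$, and let $K_n$ be the complete graph on $n$ vertices. For every integer $n \ge 2$, $$\left\lceil \frac n2 \right\rceil \le b_2(K_n),$$ and for every integer $n \ge 1$, $$b_2(K_n) \le \left\lceil \frac n2 \right\rceil + 1.$$ Moreover, for every positive integer $k$, $$b_2(K_{8k-1}) = b_2(K_{8k}) = 4k, \qquad b_2(K_{8k+1}) = 4k+1.$$ -/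

import Mathlib

/-- A biclique (complete bipartite graph) on a subset of the vertex set `V`, given by its two
disjoint partite sets. A partite set may be empty (the biclique then has no edge); this does not
influence the minimum size of an odd cover. -/
structure Biclique (V : Type*) where
  /-- the first partite set -/
  left : Finset V
  /-- the second partite set -/
  right : Finset V
  disjoint : Disjoint left right

/-- Two vertices are adjacent in a biclique when they lie in different partite sets. -/
def Biclique.Adj {V : Type*} (B : Biclique V) (u v : V) : Prop :=
  (u ∈ B.left ∧ v ∈ B.right) ∨ (u ∈ B.right ∧ v ∈ B.left)

instance Biclique.instDecidableRelAdj {V : Type*} [DecidableEq V] (B : Biclique V) :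
    DecidableRel B.Adj :=
  fun u v => inferInstanceAs
    (Decidable ((u ∈ B.left ∧ v ∈ B.right) ∨ (u ∈ B.right ∧ v ∈ B.left)))

/-- A finite collection of bicliques on `V` is an odd cover of `G` if two vertices are adjacent in
an odd number of the bicliques exactly when they are adjacent in `G`. -/
def IsOddCover {V : Type*} [DecidableEq V] {ι : Type*} [Fintype ι]
    (B : ι → Biclique V) (G : SimpleGraph V) : Prop :=
  ∀ u v : V, Odd (Finset.univ.filter fun i => (B i).Adj u v).card ↔ G.Adj u v

/-- `b₂(G)`: the minimum number of bicliques in an odd cover of `G`. -/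
noncomputable def oddCoverNumber {V : Type*} [DecidableEq V] (G : SimpleGraph V) : ℕ :=
  sInf {m : ℕ | ∃ B : Fin m → Biclique V, IsOddCover B G}

/-- On a finite vertex set an odd cover always exists, so the infimum defining `oddCoverNumber`
is a minimum. -/
theorem oddCover_nonempty {V : Type*} [Finite V] [DecidableEq V] (G : SimpleGraph V) :
    {m : ℕ | ∃ B : Fin m → Biclique V, IsOddCover B G}.Nonempty := by
  classical
  have : Fintype G.edgeSet := Fintype.ofFinite _
  have key : ∀ e : G.edgeSet, ∃ B : Biclique V, ∀ u v, B.Adj u v ↔ s(u, v) = e.1 := by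
    rintro ⟨e, he⟩
    induction e using Sym2.ind with
    | _ a b =>
      have hab : a ≠ b := G.ne_of_adj he
      refine ⟨⟨{a}, {b}, by simpa using hab⟩, fun u v => ?_⟩
      simp [Biclique.Adj]
  choose B hB using key
  refine ⟨Fintype.card G.edgeSet, fun i => B ((Fintype.equivFin G.edgeSet).symm i), ?_⟩
  intro u v
  simp only [hB]
  by_cases h : G.Adj u v
  · have : (Finset.univ.filter fun i =>
        s(u, v) = (((Fintype.equivFin G.edgeSet).symm i : G.edgeSet) : Sym2 V)) =
        {Fintype.equivFin G.edgeSet ⟨s(u, v), h⟩} := by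
      ext i
      simp only [Finset.mem_filter, Finset.mem_univ, true_and, Finset.mem_singleton]
      rw [← Equiv.symm_apply_eq, Subtype.ext_iff]
      exact eq_comm
    simp [h, this]
  · have : (Finset.univ.filter fun i =>
        s(u, v) = (((Fintype.equivFin G.edgeSet).symm i : G.edgeSet) : Sym2 V)) = ∅ := by
      ext i
      simp only [Finset.mem_filter, Finset.mem_univ, true_and, Finset.notMem_empty, iff_false]
      intro hi
      apply h
      rw [← SimpleGraph.mem_edgeSet, hi]
      exact ((Fintype.equivFin G.edgeSet).symm i).2
    simp [h, this]

-- Recording the side of each vertex in each of `m` bicliques as a sign turns an odd cover of the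
-- complete graph into vectors in {0, 1, -1}^m that pairwise disagree in sign an odd number of
-- times. Lower bound (`PairwiseOdd.isEmpty_of_card_eq`): over `ZMod 2`, 2m + 1 such vectors would
-- yield square matrices with `M * N = 1` but a zero on the diagonal of `N * M`, unless m = 0. Upper
-- bound (`HasGluableFamily.add`): suitable families can be glued, adding both sizes and lengths.
-- Copies of a family of 8 vectors of length 4 meet the lower bound at multiples of 8, and one small
-- extra block handles the other residues.

/-- The number modulo 2 of coordinates in which two sign vectors have opposite nonzero entries. -/
def signForm {ι : Type*} [Fintype ι] (x y : ι → SignType) : ZMod 2 :=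
  ∑ i, if x i * y i = -1 then 1 else 0

/-- A family of sign vectors any two distinct members of which have an odd number of opposite
nonzero coordinates. -/
def PairwiseOdd {V ι : Type*} [Fintype ι] (w : V → ι → SignType) : Prop :=
  ∀ u v, u ≠ v → signForm (w u) (w v) = 1

section SignForm

variable {ι : Type*} [Fintype ι]

theorem signForm_comm (x y : ι → SignType) : signForm x y = signForm y x := by
  simp only [signForm, mul_comm]

theorem signForm_self (x : ι → SignType) : signForm x x = 0 := by
  have h : ∀ s : SignType, s * s ≠ -1 := by decide
  simp [signForm, h]

theorem signForm_append {m n : ℕ} (a c : Fin m → SignType) (b d : Fin n → SignType) :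
    signForm (Fin.append a b) (Fin.append c d) = signForm a c + signForm b d := by
  simp only [signForm, Fin.sum_univ_add, Fin.append_left, Fin.append_right]

theorem signForm_eq_card (x y : ι → SignType) :
    signForm x y = (Finset.univ.filter fun i => x i * y i = -1).card := by
  simp [signForm]

theorem signForm_eq_one_iff (x y : ι → SignType) :
    signForm x y = 1 ↔ Odd (Finset.univ.filter fun i => x i * y i = -1).card := by
  rw [signForm_eq_card, ZMod.natCast_eq_one_iff_odd]

end SignForm

-- Odd covers of complete graphs as families of sign vectors

/-- The biclique with partite sets the vertices of sign `1` and of sign `-1`. -/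
def Biclique.ofSign {V : Type*} [Fintype V] (s : V → SignType) : Biclique V where
  left := Finset.univ.filter fun v => s v = 1
  right := Finset.univ.filter fun v => s v = -1
  disjoint := by
    rw [Finset.disjoint_filter]
    intro v _ h
    rw [h]
    decide

theorem Biclique.ofSign_adj {V : Type*} [Fintype V] (s : V → SignType) (u v : V) :
    (Biclique.ofSign s).Adj u v ↔ s u * s v = -1 := by
  have h : ∀ a b : SignType, (a = 1 ∧ b = -1) ∨ (a = -1 ∧ b = 1) ↔ a * b = -1 := by decide
  simp [Biclique.Adj, Biclique.ofSign, h]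

/-- The sign of a vertex in a biclique. -/
def Biclique.sign {V : Type*} [DecidableEq V] (B : Biclique V) (v : V) : SignType :=
  if v ∈ B.left then 1 else if v ∈ B.right then -1 else 0

theorem Biclique.adj_iff_sign {V : Type*} [DecidableEq V] (B : Biclique V) (u v : V) :
    B.Adj u v ↔ B.sign u * B.sign v = -1 := by
  have hu : u ∈ B.left → u ∉ B.right := fun h => Finset.disjoint_left.mp B.disjoint h
  have hv : v ∈ B.left → v ∉ B.right := fun h => Finset.disjoint_left.mp B.disjoint h
  unfold Biclique.Adj Biclique.sign
  by_cases h1 : u ∈ B.left <;> by_cases h2 : u ∈ B.right <;> by_cases h3 : v ∈ B.left <;>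
    by_cases h4 : v ∈ B.right <;> simp_all

theorem IsOddCover.pairwiseOdd {V ι : Type*} [DecidableEq V] [Fintype ι] {B : ι → Biclique V}
    (h : IsOddCover B (SimpleGraph.completeGraph V)) :
    PairwiseOdd fun v i => (B i).sign v := by
  intro u v huv
  rw [signForm_eq_one_iff]
  simpa only [Biclique.adj_iff_sign, SimpleGraph.completeGraph, SimpleGraph.top_adj, huv, ne_eq,
    not_false_eq_true, iff_true] using h u v

theorem PairwiseOdd.isOddCover {V ι : Type*} [DecidableEq V] [Fintype V] [Fintype ι]
    {w : V → ι → SignType} (h : PairwiseOdd w) :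
    IsOddCover (fun i => Biclique.ofSign fun v => w v i) (SimpleGraph.completeGraph V) := by
  intro u v
  simp only [Biclique.ofSign_adj]
  rw [← signForm_eq_one_iff]
  rcases eq_or_ne u v with rfl | huv
  · simp [signForm_self]
  · simp [h u v huv, huv, SimpleGraph.completeGraph]

theorem PairwiseOdd.oddCoverNumber_le {n m : ℕ} {w : Fin n → Fin m → SignType}
    (h : PairwiseOdd w) : oddCoverNumber (SimpleGraph.completeGraph (Fin n)) ≤ m :=
  Nat.sInf_le ⟨_, h.isOddCover⟩

theorem exists_pairwiseOdd_oddCoverNumber (n : ℕ) :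
    ∃ w : Fin n → Fin (oddCoverNumber (SimpleGraph.completeGraph (Fin n))) → SignType,
      PairwiseOdd w := by
  obtain ⟨B, hB⟩ := Nat.sInf_mem (oddCover_nonempty (SimpleGraph.completeGraph (Fin n)))
  exact ⟨_, hB.pairwiseOdd⟩

theorem PairwiseOdd.comp {V W ι : Type*} [Fintype ι] {w : V → ι → SignType} (h : PairwiseOdd w)
    {f : W → V} (hf : Function.Injective f) : PairwiseOdd (w ∘ f) :=
  fun u v huv => h (f u) (f v) (hf.ne huv)

theorem oddCoverNumber_completeGraph_mono {n n' : ℕ} (h : n ≤ n') :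
    oddCoverNumber (SimpleGraph.completeGraph (Fin n)) ≤
      oddCoverNumber (SimpleGraph.completeGraph (Fin n')) := by
  obtain ⟨w, hw⟩ := exists_pairwiseOdd_oddCoverNumber n'
  exact (hw.comp (Fin.castLE_injective h)).oddCoverNumber_le

/-- Adding a vertex costs at most one biclique, a spanning star. -/
theorem oddCoverNumber_completeGraph_succ_le (n : ℕ) :
    oddCoverNumber (SimpleGraph.completeGraph (Fin (n + 1))) ≤
      oddCoverNumber (SimpleGraph.completeGraph (Fin n)) + 1 := by
  obtain ⟨w, hw⟩ := exists_pairwiseOdd_oddCoverNumber n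
  refine PairwiseOdd.oddCoverNumber_le
    (w := Fin.lastCases (Fin.append (fun _ => 0) fun _ => -1)
      fun v => Fin.append (w v) fun _ => 1) ?_
  intro u v
  cases u using Fin.lastCases <;> cases v using Fin.lastCases
  · simp
  · intro _
    simp only [Fin.lastCases_last, Fin.lastCases_castSucc, signForm_append]
    simp [signForm]
  · intro _
    simp only [Fin.lastCases_last, Fin.lastCases_castSucc, signForm_append]
    simp [signForm]
  · rename_i u v
    intro huv
    simp only [Fin.lastCases_castSucc, signForm_append, signForm_self, add_zero]
    exact hw u v fun h => huv (h ▸ rfl)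

-- Lower bound

/-- Bordering the indicator matrices of the two kinds of partite sets by an all-ones column gives
mutually inverse square matrices; the reversed product contradicts disjointness. -/
theorem PairwiseOdd.isEmpty_of_card_eq {V ι : Type*} [Fintype V] [Fintype ι]
    {w : V → ι → SignType} (h : PairwiseOdd w) (hc : Fintype.card V = 2 * Fintype.card ι + 1) :
    IsEmpty ι := by
  classical
  refine ⟨fun i => ?_⟩
  let x : V → ι → ZMod 2 := fun v i => if w v i = 1 then 1 else 0
  let y : V → ι → ZMod 2 := fun v i => if w v i = -1 then 1 else 0
  let M : Matrix V ((ι ⊕ ι) ⊕ Unit) (ZMod 2) := Matrix.of fun v =>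
    Sum.elim (Sum.elim (x v) (y v)) fun _ => 1
  let N : Matrix ((ι ⊕ ι) ⊕ Unit) V (ZMod 2) := Matrix.of fun a v =>
    Sum.elim (Sum.elim (y v) (x v)) (fun _ => 1) a
  have key : ∀ u v, ∑ i, x u i * y v i + ∑ i, y u i * x v i = signForm (w u) (w v) := by
    intro u v
    have hs : ∀ a b : SignType, (if a = 1 then (1 : ZMod 2) else 0) * (if b = -1 then 1 else 0) +
        (if a = -1 then 1 else 0) * (if b = 1 then 1 else 0) = if a * b = -1 then 1 else 0 := by
      decide
    rw [← Finset.sum_add_distrib]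
    exact Finset.sum_congr rfl fun i _ => hs _ _
  have hMN : M * N = 1 := by
    ext u v
    simp only [Matrix.mul_apply, M, N, Matrix.of_apply, Fintype.sum_sum_type, Sum.elim_inl, Sum.elim_inr,
      key]
    rcases eq_or_ne u v with rfl | huv
    · simp [signForm_self]
    · rw [h u v huv, Matrix.one_apply_ne huv]
      simp only [Finset.univ_unique, Finset.sum_const, Finset.card_singleton, one_smul, mul_one]
      decide
  have hNM : N * M = 1 := by
    rwa [Matrix.mul_eq_one_comm_of_card_eq]
    simp [hc, two_mul]
  have hi := congrFun (congrFun hNM (.inl (.inl i))) (.inl (.inl i))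
  have hz : ∀ v, y v i * x v i = 0 := by
    intro v
    have hs : ∀ a : SignType,
        (if a = -1 then (1 : ZMod 2) else 0) * (if a = 1 then 1 else 0) = 0 := by
      decide
    exact hs _
  simp [Matrix.mul_apply, M, N, hz] at hi

theorem le_two_mul_oddCoverNumber_completeGraph {n : ℕ} (hn : 2 ≤ n) :
    n ≤ 2 * oddCoverNumber (SimpleGraph.completeGraph (Fin n)) := by
  obtain ⟨w, hw⟩ := exists_pairwiseOdd_oddCoverNumber n
  generalize oddCoverNumber (SimpleGraph.completeGraph (Fin n)) = m at w hw
  by_contra! hlt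
  have hm : IsEmpty (Fin m) :=
    -- Restricting to exactly 2m + 1 vertices makes the matrices square. This leaves only m = 0,
    -- where two vertices already fail.
    (hw.comp (Fin.castLE_injective (Nat.succ_le_of_lt hlt))).isEmpty_of_card_eq (by simp)
  have h01 := hw ⟨0, by omega⟩ ⟨1, by omega⟩ (by simp)
  simp [signForm] at h01

-- Upper bound by gluing

/-- A pairwise odd family of `n` sign vectors of length `m` that can be glued to other such
families: there are two auxiliary vectors, orthogonal to each other, exactly one of which is
orthogonal to any given member of the family. -/
def HasGluableFamily (n m : ℕ) : Prop :=
  ∃ (w : Fin n → Fin m → SignType) (f g : Fin m → SignType),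
    PairwiseOdd w ∧ signForm f g = 0 ∧ ∀ v, signForm f (w v) + signForm g (w v) = 1

theorem HasGluableFamily.oddCoverNumber_le {n m : ℕ} (h : HasGluableFamily n m) :
    oddCoverNumber (SimpleGraph.completeGraph (Fin n)) ≤ m := by
  obtain ⟨w, -, -, hw, -⟩ := h
  exact hw.oddCoverNumber_le

/-- Each vector is padded with an auxiliary vector of the other family. The auxiliary vectors are
orthogonal to themselves and to each other, so padding changes nothing inside a family; its choice
makes every cross pair odd. -/
theorem HasGluableFamily.add {n m n' m' : ℕ} (h : HasGluableFamily n m)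
    (h' : HasGluableFamily n' m') : HasGluableFamily (n + n') (m + m') := by
  obtain ⟨w, f, g, hw, hfg, hs⟩ := h
  obtain ⟨w', f', g', hw', hfg', hs'⟩ := h'
  have hgf : signForm g f = 0 := by rw [signForm_comm, hfg]
  have hgf' : signForm g' f' = 0 := by rw [signForm_comm, hfg']
  let p : Fin n → Fin m' → SignType := fun v => if signForm f (w v) = 1 then f' else g'
  let q : Fin n' → Fin m → SignType := fun v => if signForm f' (w' v) = 1 then g else f
  have hpp : ∀ u v, signForm (p u) (p v) = 0 := by
    intro u v
    simp only [p]
    split_ifs <;> simp [signForm_self, *]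
  have hqq : ∀ u v, signForm (q u) (q v) = 0 := by
    intro u v
    simp only [q]
    split_ifs <;> simp [signForm_self, *]
  have hp : ∀ u, signForm f' (p u) = 0 ∧ signForm g' (p u) = 0 := by
    intro u
    simp only [p]
    split_ifs <;> simp [signForm_self, *]
  have hq : ∀ u, signForm f (q u) = 0 ∧ signForm g (q u) = 0 := by
    intro u
    simp only [q]
    split_ifs <;> simp [signForm_self, *]
  have hpq : ∀ u v, signForm (q v) (w u) + signForm (p u) (w' v) = 1 := by
    intro u v
    -- Since b = a + 1 and d = c + 1, the first term is a + c and the second is a + c + 1.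
    have bit : ∀ a b c d : ZMod 2, a + b = 1 → c + d = 1 →
        (if c = 1 then b else a) + (if a = 1 then c else d) = 1 := by decide
    refine Eq.trans ?_ (bit _ _ _ _ (hs u) (hs' v))
    simp only [p, q]
    split_ifs <;> rfl
  refine ⟨Fin.addCases (fun v => Fin.append (w v) (p v)) fun v => Fin.append (q v) (w' v),
    Fin.append f f', Fin.append g g', ?_, ?_, ?_⟩
  · intro u v
    cases u using Fin.addCases <;> cases v using Fin.addCases <;>
      simp only [Fin.addCases_left, Fin.addCases_right, signForm_append]
    · rename_i u v
      intro huv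
      rw [hpp, add_zero]
      exact hw u v fun h => huv (h ▸ rfl)
    · rename_i u v
      intro _
      rw [signForm_comm (w u), hpq]
    · rename_i u v
      intro _
      rw [signForm_comm (w' u), hpq]
    · rename_i u v
      intro huv
      rw [hqq, zero_add]
      exact hw' u v fun h => huv (h ▸ rfl)
  · rw [signForm_append, hfg, hfg', add_zero]
  · intro v
    cases v using Fin.addCases <;>
      simp only [Fin.addCases_left, Fin.addCases_right, signForm_append]
    · rename_i v
      rw [(hp v).1, (hp v).2, add_zero, add_zero, hs]
    · rename_i v
      rw [(hq v).1, (hq v).2, zero_add, zero_add, hs']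

theorem hasGluableFamily_zero : HasGluableFamily 0 0 :=
  ⟨0, 0, 0, fun u => u.elim0, by simp [signForm], fun v => v.elim0⟩

theorem hasGluableFamily_two : HasGluableFamily 2 2 :=
  ⟨![![1, 0], ![-1, 0]], ![1, 1], ![-1, -1], by unfold PairwiseOdd; decide, by decide, by decide⟩

theorem hasGluableFamily_four : HasGluableFamily 4 3 :=
  ⟨![![1, 0, 1], ![-1, 0, 1], ![0, 1, -1], ![0, -1, -1]], ![1, 1, 0], ![-1, -1, 0],
    by unfold PairwiseOdd; decide, by decide, by decide⟩

-- These are the nonzero words of the ternary tetracode, all of weight 3. Negatives disagree in 3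
-- places. Other pairs share two support coordinates, and since their difference has weight 3 they
-- agree in one and disagree in the other. With all-ones and its negative as auxiliary vectors,
-- gluability says that the length is even and the weights are odd.
set_option maxRecDepth 4000 in
theorem hasGluableFamily_eight : HasGluableFamily 8 4 :=
  ⟨![![0, 1, 1, 1], ![0, -1, -1, -1], ![1, 0, 1, -1], ![1, 1, -1, 0], ![1, -1, 0, 1],
      ![-1, 0, -1, 1], ![-1, 1, 0, -1], ![-1, -1, 1, 0]],
    ![1, 1, 1, 1], ![-1, -1, -1, -1], by unfold PairwiseOdd; decide, by decide, by decide⟩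

theorem hasGluableFamily_eight_mul (k : ℕ) : HasGluableFamily (8 * k) (4 * k) := by
  induction k with
  | zero => exact hasGluableFamily_zero
  | succ k ih => exact ih.add hasGluableFamily_eight

theorem oddCoverNumber_completeGraph_le (n : ℕ) :
    oddCoverNumber (SimpleGraph.completeGraph (Fin n)) ≤ (n + 1) / 2 + 1 := by
  have h8 := hasGluableFamily_eight_mul (n / 8)
  have bound : ∀ {a b : ℕ}, HasGluableFamily a b → n ≤ a → b ≤ (n + 1) / 2 + 1 →
      oddCoverNumber (SimpleGraph.completeGraph (Fin n)) ≤ (n + 1) / 2 + 1 :=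
    fun h ha hb => ((oddCoverNumber_completeGraph_mono ha).trans h.oddCoverNumber_le).trans hb
  -- Round the residue up to 0, 2, 4 or 8, the sizes of the available extra blocks; they cost 0, 2,
  -- 3 and 4 bicliques.
  have hr : n % 8 ≤ 2 ∧ 1 ≤ n % 8 ∨ n % 8 = 0 ∨ n % 8 = 3 ∨ n % 8 = 4 ∨ 5 ≤ n % 8 := by omega
  rcases hr with hr | hr | hr | hr | hr
  · exact bound (h8.add hasGluableFamily_two) (by omega) (by omega)
  · exact bound h8 (by omega) (by omega)
  · exact bound (h8.add hasGluableFamily_four) (by omega) (by omega)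
  · exact bound (h8.add hasGluableFamily_four) (by omega) (by omega)
  · exact bound (h8.add hasGluableFamily_eight) (by omega) (by omega)

theorem Nat.ceil_natCast_div_two (n : ℕ) : ⌈(n : ℚ) / 2⌉₊ = (n + 1) / 2 := by
  have h : (n : ℚ) ≤ 2 * ((n + 1) / 2 : ℕ) := by
    norm_cast
    omega
  refine le_antisymm (Nat.ceil_le.mpr (by linarith)) ?_
  have hc := Nat.le_ceil ((n : ℚ) / 2)
  have hn : n ≤ 2 * ⌈(n : ℚ) / 2⌉₊ := by
    have : (n : ℚ) ≤ 2 * ⌈(n : ℚ) / 2⌉₊ := by linarith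
    exact_mod_cast this
  omega

theorem theorem5p4 :
    (∀ n : ℕ, 2 ≤ n → ⌈(n : ℚ) / 2⌉₊ ≤ oddCoverNumber (SimpleGraph.completeGraph (Fin n))) ∧
    (∀ n : ℕ, 1 ≤ n → oddCoverNumber (SimpleGraph.completeGraph (Fin n)) ≤ ⌈(n : ℚ) / 2⌉₊ + 1) ∧
    (∀ k : ℕ, 1 ≤ k →
      oddCoverNumber (SimpleGraph.completeGraph (Fin (8 * k - 1))) = 4 * k ∧
      oddCoverNumber (SimpleGraph.completeGraph (Fin (8 * k))) = 4 * k ∧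
      oddCoverNumber (SimpleGraph.completeGraph (Fin (8 * k + 1))) = 4 * k + 1) := by
  refine ⟨fun n hn => ?_, fun n _ => ?_, fun k hk => ?_⟩
  · have := le_two_mul_oddCoverNumber_completeGraph hn
    rw [Nat.ceil_natCast_div_two]
    omega
  · rw [Nat.ceil_natCast_div_two]
    exact oddCoverNumber_completeGraph_le n
  · have hup := (hasGluableFamily_eight_mul k).oddCoverNumber_le
    have hmono := oddCoverNumber_completeGraph_mono (Nat.sub_le (8 * k) 1)
    have hsucc := oddCoverNumber_completeGraph_succ_le (8 * k)
    -- Both orders used here are odd, so halving rounds up, to 4k and 4k + 1.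
    have h1 := le_two_mul_oddCoverNumber_completeGraph (n := 8 * k - 1) (by omega)
    have h2 := le_two_mul_oddCoverNumber_completeGraph (n := 8 * k + 1) (by omega)
    omega
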